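/- Let $S$ be a finite semigroup, and let $2^S$ be the semigroup of subsets of $S$ with the product $T\cdot T'=\{s s' \mid s\in T,\ s'\in T'\}$. For $\mathcal X\subseteq 2^S$ write $\bigcup\mathcal X=\bigcup_{T\in\mathcal X}T\subseteq S$. For $T\in 2^S$ let $T^\omega$ denote the unique idempotent among the powers $T^n$ ($n\ge 1$), and let $T^{\omega+1}=T^\omega\cdot T$. For a subsemigroup $\mathcal S$ of $2^S$, let $\mathrm{Sat}(\mathcal S)$ be the smallest subset of $2^S$ that contains $\mathcal S$ and is closed under (1) downset: if $T'\in\mathrm{Sat}(\mathcal S)$ and $T\subseteq T'$, then $T\in\mathrm{Sat}(\mathcal S)$; (2) multiplication: if $T,T'\in\mathrm{Sat}(\mathcal S)$, then $T T'\in\mathrm{Sat}(\mathcal S)$; (3) FO-closure: if $T\in\mathrm{Sat}(\mathcal S)$, then $T^\omega\cup T^{\omega+1}\in\mathrm{Sat}(\mathcal S)$. For a finite alphabet $B$, let $B^+$ be the semigroup of nonempty finite words over $B$. A word is viewed as a structure whose elements are its positions, and first-order formulas use the order $<$ on positions and, for each letter $b\in B$, a unary predicate $b(x)$ that selects the positions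 labelled $b$. A sentence $\varphi$ defines the language $\{w\in B^+ \mid w\models\varphi\}$, and its rank is its quantifier rank, the largest number of nested quantifiers. An FO-partition of $B^+$ is a finite partition of $B^+$ all of whose blocks are definable by first-order sentences. **Proposition.** Let $S$ be a finite semigroup, $\mathcal S$ a subsemigroup of $2^S$, $B$ a finite alphabet and $\beta:B^+\to\mathcal S$ a surjective semigroup morphism. Then there exists an FO-partition $\mathbf K$ of $B^+$ such that for all $K\in\mathbf K$: 1. $\bigcup\beta(K)\in\mathrm{Sat}(\mathcal S)$, where $\beta(K)=\{\beta(w)\mid w\in K\}$; 2. $K$ can be defined by a first-order sentence of rank at most $|B|\cdot 2^{|\bigcup\mathcal S|^2}$. -/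

import Mathlib

open scoped Pointwise

namespace FOSeparation

universe u v

/-! ### Finite words and first-order logic over words

The set `B⁺` of nonempty finite words over the alphabet `B` is `FreeSemigroup B`. -/

section Words

variable {B : Type u}

/-- The list of letters of a nonempty word. -/
def letters (w : FreeSemigroup B) : List B := w.head :: w.tail

/-- The positions of a word. -/
def Pos (w : FreeSemigroup B) : Type := Fin (letters w).length

/-- The predicate symbols of `FO(<)`: a unary symbol for each letter and a binary symbol `<`. -/
inductive WordRel (B : Type u) : ℕ → Type u
  | letter (b : B) : WordRel B 1
  | lt : WordRel B 2

/-- The signature of `FO(<)` on words over `B` (there are no function symbols). -/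
def wordLang (B : Type u) : FirstOrder.Language.{0, u} := ⟨fun _ => Empty, WordRel B⟩

/-- A word viewed as a structure: the domain is its set of positions, `letter b` selects the
positions labelled `b`, and `lt` is the order of positions. -/
instance wordStructure (w : FreeSemigroup B) : (wordLang B).Structure (Pos w) where
  funMap := fun f _ => f.elim
  RelMap := fun {_} r =>
    match r with
    | WordRel.letter b => fun x => (letters w).get (x 0) = b
    | WordRel.lt => fun x => Fin.val (x 0) < Fin.val (x 1)

/-- The quantifier rank of a first-order formula. -/
def qrank {L : FirstOrder.Language} {α : Type*} :
    {n : ℕ} → L.BoundedFormula α n → ℕ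
  | _, .falsum => 0
  | _, .equal _ _ => 0
  | _, .rel _ _ => 0
  | _, .imp φ ψ => max (qrank φ) (qrank ψ)
  | _, .all φ => qrank φ + 1

/-- The language `{w ∈ B⁺ | w ⊨ φ}` defined by a sentence `φ`. -/
def definedBy (φ : (wordLang B).Sentence) : Set (FreeSemigroup B) :=
  {w | FirstOrder.Language.Sentence.Realize (Pos w) φ}

/-- First-order definable languages. -/
def IsFO (K : Set (FreeSemigroup B)) : Prop :=
  ∃ φ : (wordLang B).Sentence, definedBy φ = K

/-- An FO-partition of `B⁺`: a finite partition of `B⁺` (into nonempty blocks) all of whose blocks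
are first-order definable. -/
structure IsFOPartition (P : Set (Set (FreeSemigroup B))) : Prop where
  finite : P.Finite
  isPartition : Setoid.IsPartition P
  isFO : ∀ K ∈ P, IsFO K

end Words

/-! ### Powers in a semigroup -/

section Powers

variable {X : Type u} [Semigroup X]

/-- The power `s ^ n` (`n ≥ 1`) in a semigroup. -/
def spow (s : X) (n : ℕ+) : X := PNat.recOn n s fun _ t => t * s

theorem spow_one (s : X) : spow s 1 = s := rfl

theorem spow_succ (s : X) (n : ℕ+) : spow s (n + 1) = spow s n * s := by
  simp [spow, PNat.recOn_succ]

theorem spow_add (s : X) (m n : ℕ+) : spow s (m + n) = spow s m * spow s n := by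
  induction n using PNat.recOn with
  | one => rw [spow_succ, spow_one]
  | succ n ih => rw [← add_assoc, spow_succ, ih, spow_succ, mul_assoc]

/-- In a finite semigroup every element has an idempotent power `s ^ ω`. -/
theorem exists_idempotent_spow [Finite X] (s : X) : ∃ n : ℕ+, IsIdempotentElem (spow s n) := by
  obtain ⟨i, p, h⟩ : ∃ i p : ℕ+, spow s (i + p) = spow s i := by
    obtain ⟨a, b, hab, h⟩ := Finite.exists_ne_map_eq_of_infinite (spow s)
    rcases lt_or_gt_of_ne hab with hlt | hlt
    · exact ⟨a, b - a, by rw [PNat.add_sub_of_lt hlt, h]⟩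
    · exact ⟨b, a - b, by rw [PNat.add_sub_of_lt hlt, h]⟩
  have h1 : ∀ k : ℕ+, spow s (i + k * p) = spow s i := by
    intro k
    induction k using PNat.recOn with
    | one => rw [one_mul, h]
    | succ k ih =>
      rw [add_mul, one_mul, ← add_assoc, add_right_comm, spow_add, h, ← spow_add, ih]
  have h2 : ∀ k : ℕ+, spow s (i * p + k * p) = spow s (i * p) := by
    intro k
    by_cases hp : p = 1
    · subst hp; simpa using h1 k
    · obtain ⟨q, hq⟩ : ∃ q, i * p = i + q :=
        ⟨i * p - i, (PNat.add_sub_of_lt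
          (lt_mul_of_one_lt_right' i (lt_of_le_of_ne (one_le (a := p)) (Ne.symm hp)))).symm⟩
      rw [hq, add_right_comm, spow_add, h1, ← spow_add]
  exact ⟨i * p, by rw [IsIdempotentElem, ← spow_add, h2]⟩

/-- The idempotent power `s ^ ω` does not depend on the exponent. -/
theorem idempotent_spow_unique (s : X) {m n : ℕ+} (hm : IsIdempotentElem (spow s m))
    (hn : IsIdempotentElem (spow s n)) : spow s m = spow s n := by
  have key : ∀ {a : ℕ+}, IsIdempotentElem (spow s a) → ∀ k : ℕ+, spow s (a * k) = spow s a := by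
    intro a ha k
    induction k using PNat.recOn with
    | one => rw [mul_one]
    | succ k ih => rw [mul_add, mul_one, spow_add, ih, ha]
  rw [← key hm n, ← key hn m, mul_comm]

end Powers

/-! ### Saturation -/

section Saturation

variable {S : Type v} [Semigroup S]

/-- Membership in the least subset of `2^S` that contains `𝒮` and is closed under downset,
multiplication and FO-closure. In the last rule `n` is any exponent for which `T ^ n` is
idempotent, that is, `T ^ n = T ^ ω`, so that `T ^ (n + 1) = T ^ (ω + 1)`. -/
inductive MemSat (𝒮 : Subsemigroup (Set S)) : Set S → Prop
  | base {T : Set S} (hT : T ∈ 𝒮) : MemSat 𝒮 T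
  | downset {T T' : Set S} (hT' : MemSat 𝒮 T') (h : T ⊆ T') : MemSat 𝒮 T
  | mul {T T' : Set S} (hT : MemSat 𝒮 T) (hT' : MemSat 𝒮 T') : MemSat 𝒮 (T * T')
  | foClosure {T : Set S} (hT : MemSat 𝒮 T) (n : ℕ+) (hn : IsIdempotentElem (spow T n)) :
      MemSat 𝒮 (spow T n ∪ spow T (n + 1))

/-- The saturation `Sat(𝒮)`. -/
def Sat (𝒮 : Subsemigroup (Set S)) : Set (Set S) := {T | MemSat 𝒮 T}

end Saturation

end FOSeparation

/-! The blocks of the partition are the classes of words of equal Ehrenfeucht–Fraïssé type of rank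
`k = |B| * 2 ^ |⋃ 𝒮| ^ 2`. Let `R` be the subsemigroup of `S` generated by the union of the values
of the letters. By induction on `|R|` and on the number of letters, the values of all words of one
type are contained in a common member of `Sat 𝒮`.

If `aR = R = Ra` for every letter `a`, then this equation persists for all sets generated from the
letters by multiplication and FO-closure. A primitive idempotent `e` among these sets satisfies
`eTe ⊆ e` for all of them, so that `R = eRe ⊆ e` and `R` itself lies in `Sat 𝒮`.

Otherwise `Rb ≠ R` or `bR ≠ R` for some letter `b`. Cut a word into blocks, each a run of other
letters followed by a run of `b` (or in the opposite order), and replace each block by the set of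
values of the blocks of its type. These sets are the letters of a new word, and they lie in the
proper subsemigroup `Rb` (or `bR`) of `R`. The runs themselves use fewer letters or only the letter
`b`, in which case `b ^ i` for large `i` is contained in `(b ^ ω ∪ b ^ (ω + 1)) ^ ω`. -/

namespace FOSeparation

universe u v

/-! ### Rank types of words -/

section RankTypes

variable {α : Type u}

/-- The Ehrenfeucht–Fraïssé types of rank `k` of finite words over `α`. The positions of a word are
linearly ordered, so a move of Spoiler cuts the word into a left factor, a letter and a right
factor, and the game continues on the two factors independently; hence a type of rank `k + 1` is a
set of such triples. -/
def RankType (α : Type u) : ℕ → Type u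
  | 0 => PUnit
  | k + 1 => Set (RankType α k × α × RankType α k)

instance RankType.instFinite [Finite α] : ∀ k, Finite (RankType α k)
  | 0 => inferInstanceAs (Finite PUnit)
  | k + 1 =>
    have := RankType.instFinite k
    inferInstanceAs (Finite (Set (RankType α k × α × RankType α k)))

/-- The Ehrenfeucht–Fraïssé type of rank `k` of a word: two words have the same type if and only if
no first-order sentence of quantifier rank at most `k` tells them apart. -/
def rankType : (k : ℕ) → List α → RankType α k
  | 0, _ => PUnit.unit
  | k + 1, w => {t : RankType α k × α × RankType α k |
      ∃ u a v, w = u ++ a :: v ∧ (rankType k u, a, rankType k v) = t}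

variable {k : ℕ} {u u' v v' w w' : List α}

theorem rankType_succ_eq_iff {τ : Set (RankType α k × α × RankType α k)} :
    rankType (k + 1) w = τ ↔
      ∀ t, (∃ u a v, w = u ++ a :: v ∧ (rankType k u, a, rankType k v) = t) ↔ t ∈ τ :=
  Set.ext_iff

theorem exists_split_of_rankType_succ_eq {a : α}
    (h : rankType (k + 1) (u ++ a :: v) = rankType (k + 1) w') :
    ∃ u' v', w' = u' ++ a :: v' ∧ rankType k u = rankType k u' ∧ rankType k v = rankType k v' := by
  obtain ⟨u', a', v', hw', ht⟩ := (rankType_succ_eq_iff.1 h _).1 ⟨u, a, v, rfl, rfl⟩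
  obtain ⟨hu, rfl, hv⟩ := by simpa only [Prod.mk.injEq] using ht
  exact ⟨u', v', hw', hu.symm, hv.symm⟩

theorem rankType_succ_eq
    (h : ∀ u a v, w = u ++ a :: v →
      ∃ u' v', w' = u' ++ a :: v' ∧ rankType k u = rankType k u' ∧ rankType k v = rankType k v')
    (h' : ∀ u a v, w' = u ++ a :: v →
      ∃ u' v', w = u' ++ a :: v' ∧ rankType k u = rankType k u' ∧ rankType k v = rankType k v') :
    rankType (k + 1) w = rankType (k + 1) w' := by
  refine rankType_succ_eq_iff.2 fun t => ⟨?_, ?_⟩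
  · rintro ⟨u, a, v, hw, rfl⟩
    obtain ⟨u', v', hw', hu, hv⟩ := h u a v hw
    exact ⟨u', a, v', hw', by rw [hu, hv]⟩
  · rintro ⟨u, a, v, hw, rfl⟩
    obtain ⟨u', v', hw', hu, hv⟩ := h' u a v hw
    exact ⟨u', a, v', hw', by rw [hu, hv]⟩

theorem rankType_eq_of_succ (h : rankType (k + 1) w = rankType (k + 1) w') :
    rankType k w = rankType k w' := by
  induction k generalizing w w' with
  | zero => rfl
  | succ k ih =>
    have respond : ∀ {w w' : List α}, rankType (k + 2) w = rankType (k + 2) w' → ∀ u a v,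
        w = u ++ a :: v → ∃ u' v', w' = u' ++ a :: v' ∧ rankType k u = rankType k u' ∧
          rankType k v = rankType k v' := by
      rintro w w' h u a v rfl
      obtain ⟨u', v', hw', hu, hv⟩ := exists_split_of_rankType_succ_eq h
      exact ⟨u', v', hw', ih hu, ih hv⟩
    exact rankType_succ_eq (respond h) (respond h.symm)

theorem rankType_eq_of_le {j : ℕ} (hjk : j ≤ k) (h : rankType k w = rankType k w') :
    rankType j w = rankType j w' := by
  induction hjk with
  | refl => exact h
  | step _ ih => exact ih (rankType_eq_of_succ h)

theorem rankType_append (hu : rankType k u = rankType k u') (hv : rankType k v = rankType k v') :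
    rankType k (u ++ v) = rankType k (u' ++ v') := by
  induction k generalizing u u' v v' with
  | zero => rfl
  | succ k ih =>
    have respond : ∀ {u u' v v' : List α}, rankType (k + 1) u = rankType (k + 1) u' →
        rankType (k + 1) v = rankType (k + 1) v' → ∀ x a y, u ++ v = x ++ a :: y →
          ∃ x' y', u' ++ v' = x' ++ a :: y' ∧ rankType k x = rankType k x' ∧
            rankType k y = rankType k y' := by
      intro u u' v v' hu hv x a y h
      rcases List.append_eq_append_iff.1 h with ⟨z, rfl, rfl⟩ | ⟨z, rfl, hz⟩
      · obtain ⟨x', y', rfl, hx, hy⟩ := exists_split_of_rankType_succ_eq hv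
        exact ⟨u' ++ x', y', by simp, ih (rankType_eq_of_succ hu) hx, hy⟩
      · rcases List.cons_eq_append_iff.1 hz with ⟨rfl, rfl⟩ | ⟨z, rfl, rfl⟩
        · obtain ⟨x', y', rfl, hx, hy⟩ := exists_split_of_rankType_succ_eq (u := []) hv
          rw [List.append_nil] at hu
          exact ⟨u' ++ x', y', by simp, by simpa using ih (rankType_eq_of_succ hu) hx, hy⟩
        · obtain ⟨x', y', rfl, hx, hy⟩ := exists_split_of_rankType_succ_eq hu
          exact ⟨x', y' ++ v', by simp, hx, ih hy (rankType_eq_of_succ hv)⟩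
    exact rankType_succ_eq (respond hu hv) (respond hu.symm hv.symm)

theorem rankType_map {β : Type v} (f : α → β) (h : rankType k w = rankType k w') :
    rankType k (w.map f) = rankType k (w'.map f) := by
  induction k generalizing w w' with
  | zero => rfl
  | succ k ih =>
    have respond : ∀ {w w' : List α}, rankType (k + 1) w = rankType (k + 1) w' → ∀ u b v,
        w.map f = u ++ b :: v → ∃ u' v', w'.map f = u' ++ b :: v' ∧ rankType k u = rankType k u' ∧
          rankType k v = rankType k v' := by
      intro w w' h u b v hw
      obtain ⟨u, z, rfl, rfl, hz⟩ := List.map_eq_append_iff.1 hw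
      obtain ⟨a, v, rfl, rfl, rfl⟩ := List.map_eq_cons_iff.1 hz
      obtain ⟨u', v', rfl, hu, hv⟩ := exists_split_of_rankType_succ_eq h
      exact ⟨u'.map f, v'.map f, by simp, ih hu, ih hv⟩
    exact rankType_succ_eq (respond h) (respond h.symm)

theorem rankType_reverse (h : rankType k w = rankType k w') :
    rankType k w.reverse = rankType k w'.reverse := by
  induction k generalizing w w' with
  | zero => rfl
  | succ k ih =>
    have respond : ∀ {w w' : List α}, rankType (k + 1) w = rankType (k + 1) w' → ∀ u a v,
        w.reverse = u ++ a :: v → ∃ u' v', w'.reverse = u' ++ a :: v' ∧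
          rankType k u = rankType k u' ∧ rankType k v = rankType k v' := by
      intro w w' h u a v hw
      obtain rfl : w = v.reverse ++ a :: u.reverse := by
        rw [← w.reverse_reverse, hw]; simp
      obtain ⟨v', u', rfl, hv, hu⟩ := exists_split_of_rankType_succ_eq h
      exact ⟨u'.reverse, v'.reverse, by simp, by simpa using ih hu, by simpa using ih hv⟩
    exact rankType_succ_eq (respond h) (respond h.symm)

theorem forall_mem_of_rankType_succ_eq {p : α → Prop} (h : rankType (k + 1) w = rankType (k + 1) w')
    (hw : ∀ a ∈ w, p a) : ∀ a ∈ w', p a := by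
  intro a ha
  obtain ⟨u, v, rfl⟩ := List.append_of_mem ha
  obtain ⟨u', v', rfl, -, -⟩ := exists_split_of_rankType_succ_eq h.symm
  exact hw a (by simp)

theorem eq_nil_of_rankType_succ_eq (h : rankType (k + 1) [] = rankType (k + 1) w) : w = [] :=
  List.eq_nil_iff_forall_not_mem.2
    (forall_mem_of_rankType_succ_eq (p := fun _ => False) h (by simp))

theorem exists_cons_of_rankType_eq {a : α}
    (h : rankType (k + 2) (a :: v) = rankType (k + 2) w') :
    ∃ v', w' = a :: v' ∧ rankType (k + 1) v = rankType (k + 1) v' := by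
  obtain ⟨u', v', rfl, hu, hv⟩ := exists_split_of_rankType_succ_eq (u := []) h
  obtain rfl := eq_nil_of_rankType_succ_eq hu
  exact ⟨v', rfl, hv⟩

theorem getLast?_eq_of_rankType_eq (h : rankType (k + 2) w = rankType (k + 2) w') :
    w.getLast? = w'.getLast? := by
  rcases w.eq_nil_or_concat' with rfl | ⟨u, a, rfl⟩
  · rw [eq_nil_of_rankType_succ_eq h]
  · obtain ⟨u', v', rfl, -, hv⟩ := exists_split_of_rankType_succ_eq h
    rw [eq_nil_of_rankType_succ_eq hv]
    simp

theorem length_eq_or_le_of_rankType_eq (h : rankType k w = rankType k w') :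
    w.length = w'.length ∨ k ≤ w.length ∧ k ≤ w'.length := by
  induction k generalizing w w' with
  | zero => simp
  | succ k ih =>
    rcases w with _ | ⟨a, w⟩
    · rw [eq_nil_of_rankType_succ_eq h]; simp
    rcases k with _ | k
    · obtain ⟨u', v', rfl, -, -⟩ := exists_split_of_rankType_succ_eq (u := []) h
      right
      simp [← add_assoc]
    · obtain ⟨v', rfl, hv⟩ := exists_cons_of_rankType_eq h
      simpa using ih hv

end RankTypes

/-! ### Decomposition of words into blocks -/

section Blocks

variable {α : Type u} {p : α → Prop} {k j : ℕ} {u u' v v' : List α}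

/-- Marking the border between a run of letters that satisfy `p` and the rest costs one round: if
Duplicator answered beyond or before the border, she would lose the next round. -/
theorem rankType_eq_and_of_append_left (hu : ∀ a ∈ u, p a) (hv : ∀ a ∈ v.head?, ¬p a)
    (hu' : ∀ a ∈ u', p a) (hv' : ∀ a ∈ v'.head?, ¬p a)
    (h : rankType (k + 2) (u ++ v) = rankType (k + 2) (u' ++ v')) :
    rankType (k + 1) u = rankType (k + 1) u' ∧ rankType (k + 1) v = rankType (k + 1) v' := by
  rcases v with _ | ⟨a, t⟩
  · have hall : ∀ a ∈ u' ++ v', p a := forall_mem_of_rankType_succ_eq h (by simpa using hu)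
    obtain rfl : v' = [] := by
      rcases v' with _ | ⟨a, t⟩
      · rfl
      · exact absurd (hall a (by simp)) (hv' a rfl)
    exact ⟨by simpa using rankType_eq_of_succ h, rfl⟩
  · obtain ⟨x, y, hxy, hx, hy⟩ := exists_split_of_rankType_succ_eq h
    have hpx : ∀ a ∈ x, p a := forall_mem_of_rankType_succ_eq hx hu
    have ha : ¬p a := hv a rfl
    obtain ⟨rfl, rfl⟩ : x = u' ∧ a :: y = v' := by
      rcases List.append_eq_append_iff.1 hxy with ⟨c, rfl, rfl⟩ | ⟨c, rfl, hc⟩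
      · rcases c with _ | ⟨b, c⟩
        · simp
        · exact absurd (hpx b (by simp)) (hv' b rfl)
      · rcases c with _ | ⟨b, c⟩
        · simp_all
        · obtain ⟨rfl, -⟩ := List.cons.inj hc
          exact absurd (hu' a (by simp)) ha
    exact ⟨hx, rankType_append (u := [a]) rfl hy⟩

theorem rankType_eq_and_of_append_right (hu : ∀ a ∈ u.getLast?, ¬p a) (hv : ∀ a ∈ v, p a)
    (hu' : ∀ a ∈ u'.getLast?, ¬p a) (hv' : ∀ a ∈ v', p a)
    (h : rankType (k + 2) (u ++ v) = rankType (k + 2) (u' ++ v')) :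
    rankType (k + 1) u = rankType (k + 1) u' ∧ rankType (k + 1) v = rankType (k + 1) v' := by
  have h := rankType_reverse h
  rw [List.reverse_append, List.reverse_append] at h
  obtain ⟨hv, hu⟩ := rankType_eq_and_of_append_left (p := p) (by simpa using hv) (by simpa using hu)
    (by simpa using hv') (by simpa using hu') h
  exact ⟨by simpa using rankType_reverse hu, by simpa using rankType_reverse hv⟩

/-- A block is a nonempty run of letters that satisfy `p` followed by a nonempty run of letters
that do not. -/
def IsBlock (p : α → Prop) (z : List α) : Prop :=
  ∃ x y, z = x ++ y ∧ x ≠ [] ∧ y ≠ [] ∧ (∀ a ∈ x, p a) ∧ ∀ a ∈ y, ¬p a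

theorem exists_eq_append_flatten_append (p : α → Prop) (v : List α) :
    ∃ y Z x, v = y ++ (List.flatten Z ++ x) ∧ (∀ a ∈ y, ¬p a) ∧ (∀ z ∈ Z, IsBlock p z) ∧
      ∀ a ∈ x, p a := by
  induction v with
  | nil => exact ⟨[], [], [], by simp⟩
  | cons a v ih =>
    obtain ⟨y, Z, x, rfl, hy, hZ, hx⟩ := ih
    by_cases ha : p a
    swap
    · exact ⟨a :: y, Z, x, rfl, by simpa using ⟨ha, hy⟩, hZ, hx⟩
    rcases eq_or_ne y [] with rfl | hne
    swap
    · refine ⟨[], (a :: y) :: Z, x, by simp, by simp, ?_, hx⟩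
      exact List.forall_mem_cons.2 ⟨⟨[a], y, rfl, by simp, hne, by simpa using ha, hy⟩, hZ⟩
    rcases Z with _ | ⟨z, Z⟩
    · exact ⟨[], [], a :: x, rfl, by simp, by simp, by simpa using ⟨ha, hx⟩⟩
    · rw [List.forall_mem_cons] at hZ
      obtain ⟨⟨x', y', rfl, -, hy'ne, hx', hy'⟩, hZ⟩ := hZ
      refine ⟨[], (a :: x' ++ y') :: Z, x, by simp, by simp, ?_, hx⟩
      exact List.forall_mem_cons.2
        ⟨⟨a :: x', y', rfl, by simp, hy'ne, by simpa using ⟨ha, hx'⟩, hy'⟩, hZ⟩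

theorem IsBlock.exists_eq_cons {z : List α} (hz : IsBlock p z) : ∃ a t, z = a :: t ∧ p a := by
  obtain ⟨_ | ⟨a, x⟩, y, rfl, hx, -, hpx, -⟩ := hz
  · exact absurd rfl hx
  · exact ⟨a, x ++ y, rfl, hpx a (by simp)⟩

theorem of_mem_head?_flatten_append {Z : List (List α)} {x : List α} (hZ : ∀ z ∈ Z, IsBlock p z)
    (hx : ∀ a ∈ x, p a) : ∀ a ∈ (Z.flatten ++ x).head?, p a := by
  rcases Z with _ | ⟨z, Z⟩
  · exact fun a ha => hx a (List.mem_of_mem_head? ha)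
  · obtain ⟨b, t, rfl, hb⟩ := (hZ z (by simp)).exists_eq_cons
    simpa using hb

theorem of_mem_head?_flatten {Z : List (List α)} (hZ : ∀ z ∈ Z, IsBlock p z) :
    ∀ a ∈ Z.flatten.head?, p a := by
  simpa using of_mem_head?_flatten_append (x := []) hZ (by simp)

theorem IsBlock.exists_mem_getLast?_append_flatten {z : List α} {Z : List (List α)}
    (hz : IsBlock p z) (hZ : ∀ z ∈ Z, IsBlock p z) : ∃ a ∈ (z ++ Z.flatten).getLast?, ¬p a := by
  induction Z generalizing z with
  | nil =>
    obtain ⟨x, y, rfl, -, hy, -, hpy⟩ := hz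
    obtain ⟨y, a, rfl⟩ := y.eq_nil_or_concat'.resolve_left hy
    exact ⟨a, by simp [← List.append_assoc], hpy a (by simp)⟩
  | cons z' Z ih =>
    rw [List.forall_mem_cons] at hZ
    obtain ⟨a, ha, hpa⟩ := ih hZ.1 hZ.2
    exact ⟨a, List.mem_getLast?_append_of_mem_getLast? ha, hpa⟩

theorem not_of_mem_getLast?_flatten {Z : List (List α)} (hZ : ∀ z ∈ Z, IsBlock p z) :
    ∀ a ∈ Z.flatten.getLast?, ¬p a := by
  rcases Z with _ | ⟨z, Z⟩
  · simp
  · rw [List.forall_mem_cons] at hZ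
    obtain ⟨b, hb, hpb⟩ := hZ.1.exists_mem_getLast?_append_flatten hZ.2
    rintro a ha
    exact Option.mem_unique hb ha ▸ hpb

theorem IsBlock.rankType_eq_and_of_append {z z' : List α} (hz : IsBlock p z) (hz' : IsBlock p z')
    (hv : ∀ a ∈ v.head?, p a) (hv' : ∀ a ∈ v'.head?, p a)
    (h : rankType (k + 3) (z ++ v) = rankType (k + 3) (z' ++ v')) :
    rankType (k + 1) z = rankType (k + 1) z' ∧ rankType (k + 1) v = rankType (k + 1) v' := by
  obtain ⟨x, _ | ⟨b, y⟩, rfl, -, hy, hpx, hpy⟩ := hz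
  · exact absurd rfl hy
  obtain ⟨x', _ | ⟨b', y'⟩, rfl, -, hy', hpx', hpy'⟩ := hz'
  · exact absurd rfl hy'
  rw [List.append_assoc, List.append_assoc] at h
  obtain ⟨hx, h⟩ := rankType_eq_and_of_append_left hpx
    (by simpa using hpy b (by simp)) hpx' (by simpa using hpy' b' (by simp)) h
  obtain ⟨hy, hv⟩ := rankType_eq_and_of_append_left (p := fun a => ¬p a) hpy
    (by simpa using hv) hpy' (by simpa using hv') h
  exact ⟨rankType_append (rankType_eq_of_succ hx) hy, hv⟩

theorem IsBlock.not_of_eq_append_cons {z : List α} {a b : α} (hz : IsBlock p z)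
    (h : z = u ++ a :: v) (hb : b ∈ u.getLast?) (hpb : ¬p b) : ¬p a := by
  obtain ⟨x, y, rfl, -, -, hpx, hpy⟩ := hz
  rcases List.append_eq_append_iff.1 h with ⟨c, rfl, rfl⟩ | ⟨c, rfl, -⟩
  · exact hpy a (by simp)
  · exact absurd (hpx b (List.mem_append_left c (List.mem_of_getLast? hb))) hpb

theorem exists_eq_append_cons_of_block_append_flatten {y s : List α} {a b : α} {Z : List (List α)}
    (hy : IsBlock p y) (hZ : ∀ z ∈ Z, IsBlock p z) (h : y ++ Z.flatten = u ++ a :: s)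
    (hb : b ∈ u.getLast?) (hpb : ¬p b) (ha : p a) :
    ∃ U z V, Z = U ++ z :: V ∧ u = y ++ U.flatten ∧ a :: s = z ++ V.flatten := by
  have not_inside : ∀ c, y ≠ u ++ a :: c := fun c hc =>
    hy.not_of_eq_append_cons hc hb hpb ha
  induction Z generalizing y u with
  | nil => exact absurd (by simpa using h) (not_inside s)
  | cons z Z ih =>
    rw [List.forall_mem_cons] at hZ
    rcases List.append_eq_append_iff.1 h with ⟨c, rfl, hc⟩ | ⟨c, rfl, hc⟩
    · rcases c.eq_nil_or_concat' with rfl | ⟨c, d, rfl⟩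
      · exact ⟨[], z, Z, rfl, by simp, hc.symm⟩
      · have hbd : b ∈ (c ++ [d]).getLast? := by simpa using hb
        obtain ⟨U, z', V, rfl, hu, hs⟩ := ih hZ.1 hZ.2 hc hbd fun e he =>
          hZ.1.not_of_eq_append_cons he hbd hpb ha
        exact ⟨z :: U, z', V, rfl, by simp [hu], hs⟩
    · rcases c with _ | ⟨d, c⟩
      · exact ⟨[], z, Z, rfl, by simp, hc⟩
      · obtain ⟨rfl, -⟩ := List.cons.inj hc
        exact absurd rfl (not_inside c)

theorem rankType_map_eq_of_block_append_flatten {y y' : List α} {Z Z' : List (List α)}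
    (hy : IsBlock p y) (hy' : IsBlock p y') (hZ : ∀ z ∈ Z, IsBlock p z)
    (hZ' : ∀ z ∈ Z', IsBlock p z)
    (h : rankType (k + j + 3) (y ++ Z.flatten) = rankType (k + j + 3) (y' ++ Z'.flatten)) :
    rankType k (Z.map (rankType (j + 1))) = rankType k (Z'.map (rankType (j + 1))) := by
  induction k generalizing y y' Z Z' with
  | zero => rfl
  | succ k ih =>
    have respond : ∀ {y y' : List α} {Z Z' : List (List α)}, IsBlock p y → IsBlock p y' →
        (∀ z ∈ Z, IsBlock p z) → (∀ z ∈ Z', IsBlock p z) →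
        rankType (k + 1 + j + 3) (y ++ Z.flatten) = rankType (k + 1 + j + 3) (y' ++ Z'.flatten) →
        ∀ U t V, Z.map (rankType (j + 1)) = U ++ t :: V →
          ∃ U' V', Z'.map (rankType (j + 1)) = U' ++ t :: V' ∧
            rankType k U = rankType k U' ∧ rankType k V = rankType k V' := by
      intro y y' Z Z' hy hy' hZ hZ' h U t V hUV
      obtain ⟨U, W, rfl, rfl, hW⟩ := List.map_eq_append_iff.1 hUV
      obtain ⟨z, V, rfl, rfl, rfl⟩ := List.map_eq_cons_iff.1 hW
      simp only [List.forall_mem_append, List.forall_mem_cons] at hZ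
      obtain ⟨hU, hz, hV⟩ := hZ
      obtain ⟨a, s, rfl, ha⟩ := hz.exists_eq_cons
      rw [add_right_comm k 1, add_right_comm _ 1, List.flatten_append, List.flatten_cons,
        ← List.append_assoc] at h
      obtain ⟨u', s', hs', hu, hs⟩ := exists_split_of_rankType_succ_eq h
      obtain ⟨b, hb, hpb⟩ := hy.exists_mem_getLast?_append_flatten hU
      rw [getLast?_eq_of_rankType_eq hu] at hb
      obtain ⟨U', z', V', rfl, rfl, hV'⟩ :=
        exists_eq_append_cons_of_block_append_flatten hy' hZ' hs' hb hpb ha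
      simp only [List.forall_mem_append, List.forall_mem_cons] at hZ'
      obtain ⟨hU', hz', hVb'⟩ := hZ'
      have hblocks : rankType (k + j + 3) (a :: s ++ V.flatten) =
          rankType (k + j + 3) (z' ++ V'.flatten) := by
        rw [← hV']
        exact rankType_append (u := [a]) rfl hs
      have hzz' := (hz.rankType_eq_and_of_append hz' (of_mem_head?_flatten hV)
        (of_mem_head?_flatten hVb') (rankType_eq_of_le (j := j + 3) (by omega) hblocks)).1
      exact ⟨U'.map (rankType (j + 1)), V'.map (rankType (j + 1)), by simp [← hzz'],
        ih hy hy' hU hU' hu, ih hz hz' hV hVb' hblocks⟩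
    exact rankType_succ_eq (respond hy hy' hZ hZ' h) (respond hy' hy hZ' hZ h.symm)

theorem rankType_map_eq_of_flatten {Z Z' : List (List α)}
    (hZ : ∀ z ∈ Z, IsBlock p z) (hZ' : ∀ z ∈ Z', IsBlock p z)
    (h : rankType (k + j + 3) Z.flatten = rankType (k + j + 3) Z'.flatten) :
    rankType k (Z.map (rankType (j + 1))) = rankType k (Z'.map (rankType (j + 1))) := by
  rcases Z with _ | ⟨z, Z⟩ <;> rcases Z' with _ | ⟨z', Z'⟩
  · rfl
  · obtain ⟨a, t, rfl, -⟩ := (hZ' z' (by simp)).exists_eq_cons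
    simpa using eq_nil_of_rankType_succ_eq h
  · obtain ⟨a, t, rfl, -⟩ := (hZ z (by simp)).exists_eq_cons
    simpa using eq_nil_of_rankType_succ_eq h.symm
  · rw [List.forall_mem_cons] at hZ hZ'
    have hz := (hZ.1.rankType_eq_and_of_append hZ'.1 (of_mem_head?_flatten hZ.2)
      (of_mem_head?_flatten hZ'.2) (rankType_eq_of_le (j := j + 3) (by omega) h)).1
    rw [List.map_cons, List.map_cons, hz]
    exact rankType_append (u := [_]) rfl
      (rankType_map_eq_of_block_append_flatten hZ.1 hZ'.1 hZ.2 hZ'.2 h)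

end Blocks

/-! ### Powers and idempotents -/

section Idempotents

theorem list_prod_mem_of_ne_nil {M : Type u} [Monoid M] (N : Subsemigroup M) {w : List M}
    (hw : ∀ a ∈ w, a ∈ N) (hne : w ≠ []) : w.prod ∈ N := by
  induction w with
  | nil => exact absurd rfl hne
  | cons a w ih =>
    rw [List.forall_mem_cons] at hw
    rcases eq_or_ne w [] with rfl | hne
    · simpa using hw.1
    · rw [List.prod_cons]
      exact N.mul_mem hw.1 (ih hw.2 hne)

theorem pow_mem_of_ne_zero {M : Type u} [Monoid M] (N : Subsemigroup M) {x : M} (hx : x ∈ N)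
    {n : ℕ} (hn : n ≠ 0) : x ^ n ∈ N :=
  List.prod_replicate n x ▸ list_prod_mem_of_ne_nil N
    (fun _ ha => List.eq_of_mem_replicate ha ▸ hx) (by simpa using hn)

theorem pow_add_mul_eq_pow {M : Type u} [Monoid M] {x : M} {i p d : ℕ}
    (h : x ^ (p + d) = x ^ p) (hi : p ≤ i) (k : ℕ) : x ^ (i + k * d) = x ^ i := by
  obtain ⟨c, rfl⟩ := Nat.exists_eq_add_of_le hi
  induction k with
  | zero => simp
  | succ k ih =>
    rw [show p + c + (k + 1) * d = (p + d) + (c + k * d) by ring, pow_add, h, ← pow_add,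
      ← add_assoc, ih]

theorem exists_isIdempotentElem_pow {M : Type u} [Monoid M] {s : Set M} (hs : s.Finite) {x : M}
    (hx : ∀ n ≠ 0, x ^ n ∈ s) :
    ∃ n ≠ 0, IsIdempotentElem (x ^ n) ∧ ∀ i, s.ncard ≤ i → x ^ i * x ^ n = x ^ i := by
  obtain ⟨p, d, hp, hps, hd, h⟩ : ∃ p d, p ≠ 0 ∧ p ≤ s.ncard ∧ d ≠ 0 ∧ x ^ (p + d) = x ^ p := by
    obtain ⟨i, hi, j, hj, hij, h⟩ := Set.exists_ne_map_eq_of_ncard_lt_of_maps_to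
      (s := Set.Icc 1 (s.ncard + 1)) (t := s) (f := fun n => x ^ n) (by simp)
      (fun n hn => hx n (Nat.one_le_iff_ne_zero.1 hn.1)) hs
    simp only [Set.mem_Icc] at hi hj
    rcases hij.lt_or_gt with hlt | hlt
    · exact ⟨i, j - i, by omega, by omega, by omega, by rw [Nat.add_sub_of_le hlt.le, h]⟩
    · exact ⟨j, i - j, by omega, by omega, by omega, by rw [Nat.add_sub_of_le hlt.le, h]⟩
  refine ⟨p * d, mul_ne_zero hp hd, ?_, fun i hi => ?_⟩
  · rw [IsIdempotentElem, ← pow_add]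
    exact pow_add_mul_eq_pow h (Nat.le_mul_of_pos_right p (Nat.pos_of_ne_zero hd)) p
  · rw [← pow_add]
    exact pow_add_mul_eq_pow h (hps.trans hi) p

theorem exists_primitive_idempotent {M : Type u} [Semigroup M] {E : Set M} (hE : E.Finite)
    (hne : E.Nonempty) (hidem : ∀ e ∈ E, IsIdempotentElem e) :
    ∃ e ∈ E, ∀ f ∈ E, e * f = f → f * e = f → f = e := by
  obtain ⟨e, heE, hmin⟩ := hE.exists_minimalFor (fun e => {x | e * x = x ∧ x * e = x}) E hne
  refine ⟨e, heE, fun f hf hef hfe => ?_⟩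
  have hle : {x | f * x = x ∧ x * f = x} ⊆ {x | e * x = x ∧ x * e = x} := by
    rintro x ⟨hfx, hxf⟩
    exact ⟨by rw [← hfx, ← mul_assoc, hef], by rw [← hxf, mul_assoc, hfe]⟩
  exact hfe.symm.trans (hmin hf hle ⟨hidem e heE, hidem e heE⟩).1

end Idempotents

/-! ### Saturated families of sets -/

section Saturated

variable {M : Type u} [Monoid M]

theorem subset_of_union_pow_eq {e X : Set M} (he : IsIdempotentElem e) (hXe : X * e = X) {n : ℕ}
    (hn : n ≠ 0) (h : (e ∪ X) ^ n = e) : X ⊆ e := by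
  have subset_pow : ∀ i, e ∪ X ⊆ (e ∪ X) ^ (i + 1) := by
    intro i
    induction i with
    | zero => simp
    | succ i ih =>
      calc e ∪ X = (e ∪ X) * e := by rw [Set.union_mul, he, hXe]
        _ ⊆ (e ∪ X) ^ (i + 1) * (e ∪ X) := Set.mul_subset_mul ih Set.subset_union_left
        _ = (e ∪ X) ^ (i + 2) := (pow_succ _ _).symm
  calc X ⊆ e ∪ X := Set.subset_union_right
    _ ⊆ (e ∪ X) ^ (n - 1 + 1) := subset_pow _
    _ = e := by rw [Nat.sub_one_add_one hn, h]

/-- The idempotent power `X ^ ω` of `X = e * T * e` is `e` if `e` is primitive, so `e ∪ X` lies in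
the family; its idempotent power is again `e`, and it contains `X`. -/
theorem exists_mul_mul_subset_self {N : Subsemigroup (Set M)} (hfin : (N : Set (Set M)).Finite)
    (hne : (N : Set (Set M)).Nonempty)
    (hFO : ∀ T ∈ N, ∀ n ≠ 0, IsIdempotentElem (T ^ n) → T ^ n ∪ T ^ (n + 1) ∈ N) :
    ∃ e ∈ N, ∀ T ∈ N, e * T * e ⊆ e := by
  have exists_pow : ∀ T ∈ N, ∃ n ≠ 0, IsIdempotentElem (T ^ n) := fun T hT =>
    (exists_isIdempotentElem_pow hfin fun n hn => pow_mem_of_ne_zero N hT hn).imp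
      fun _ h => ⟨h.1, h.2.1⟩
  obtain ⟨e, ⟨heN, he⟩, hprim⟩ := exists_primitive_idempotent
    (hfin.subset (Set.sep_subset (N : Set (Set M)) IsIdempotentElem))
    (by
      obtain ⟨T, hT⟩ := hne
      obtain ⟨n, hn, hidem⟩ := exists_pow T hT
      exact ⟨T ^ n, pow_mem_of_ne_zero N hT hn, hidem⟩)
    fun _ h => h.2
  have exists_pow_eq : ∀ X ∈ N, e * X = X → X * e = X → ∃ n ≠ 0, X ^ n = e := by
    intro X hX heX hXe
    obtain ⟨n, hn, hidem⟩ := exists_pow X hX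
    refine ⟨n, hn, hprim _ ⟨pow_mem_of_ne_zero N hX hn, hidem⟩ ?_ ?_⟩
    · rw [← mul_pow_sub_one hn, ← mul_assoc, heX]
    · rw [← pow_sub_one_mul hn, mul_assoc, hXe]
  refine ⟨e, heN, fun T hT => ?_⟩
  have heX : e * (e * T * e) = e * T * e := by rw [← mul_assoc, ← mul_assoc, he]
  have hXe : e * T * e * e = e * T * e := by rw [mul_assoc, he]
  have hXN : e * T * e ∈ N := N.mul_mem (N.mul_mem heN hT) heN
  generalize e * T * e = X at heX hXe hXN ⊢
  obtain ⟨n, hn, hXn⟩ := exists_pow_eq X hXN heX hXe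
  have hY : e ∪ X ∈ N := by
    have := hFO X hXN n hn (hXn ▸ he)
    rwa [pow_succ, hXn, heX] at this
  obtain ⟨m, hm, hYm⟩ := exists_pow_eq (e ∪ X) hY (by rw [Set.mul_union, he, heX])
    (by rw [Set.union_mul, he, hXe])
  exact subset_of_union_pow_eq he hXe hm hYm

/-- The closure conditions of `Sat`, for a family of subsets of a monoid that contains `1`. -/
structure IsFOSaturated (F : Submonoid (Set M)) : Prop where
  isLowerSet : IsLowerSet (F : Set (Set M))
  pow_union_pow_succ_mem : ∀ {T : Set M} {n : ℕ}, T ∈ F → n ≠ 0 → IsIdempotentElem (T ^ n) →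
    T ^ n ∪ T ^ (n + 1) ∈ F

/-- The subsets of a subsemigroup, as a subsemigroup of the semigroup of subsets. -/
def powersetSubsemigroup (R : Subsemigroup M) : Subsemigroup (Set M) where
  carrier := 𝒫 (R : Set M)
  mul_mem' hT hT' := Set.mul_subset_iff.2 fun _ hx _ hy => R.mul_mem (hT hx) (hT' hy)

variable {F : Submonoid (Set M)} {A : Set (Set M)}

theorem exists_mem_of_mem_closure_sUnion {N : Subsemigroup (Set M)} (hA : A ⊆ N) {x : M}
    (hx : x ∈ Subsemigroup.closure (⋃₀ A)) : ∃ T ∈ N, x ∈ T := by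
  induction hx using Subsemigroup.closure_induction with
  | mem x hx =>
    obtain ⟨a, ha, hxa⟩ := hx
    exact ⟨a, hA ha, hxa⟩
  | mul x y _ _ hx hy =>
    obtain ⟨T, hT, hxT⟩ := hx
    obtain ⟨T', hT', hyT'⟩ := hy
    exact ⟨T * T', N.mul_mem hT hT', Set.mul_mem_mul hxT hyT'⟩

theorem prod_subset_closure_sUnion {w : List (Set M)} (hw : ∀ a ∈ w, a ∈ A) (hne : w ≠ []) :
    w.prod ⊆ Subsemigroup.closure (⋃₀ A) :=
  list_prod_mem_of_ne_nil (powersetSubsemigroup _)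
    (fun a ha => (Set.subset_sUnion_of_mem (hw a ha)).trans Subsemigroup.subset_closure) hne

theorem IsFOSaturated.closure_mem_of_subsingleton (hF : IsFOSaturated F) (hA : A ⊆ F)
    (hR : (Subsemigroup.closure (⋃₀ A) : Set M).Subsingleton) :
    (Subsemigroup.closure (⋃₀ A) : Set M) ∈ F := by
  rcases hR.eq_empty_or_singleton with h | ⟨x, h⟩
  · exact h ▸ hF.isLowerSet (Set.empty_subset 1) F.one_mem
  · obtain ⟨T, hT, hxT⟩ := exists_mem_of_mem_closure_sUnion (N := F.toSubsemigroup) hA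
      (SetLike.mem_coe.1 (h ▸ Set.mem_singleton x))
    exact h ▸ hF.isLowerSet (Set.singleton_subset_iff.2 hxT) hT

theorem IsFOSaturated.closure_mem (hF : IsFOSaturated F) (hA : A ⊆ F) (hne : A.Nonempty)
    (hfin : (Subsemigroup.closure (⋃₀ A) : Set M).Finite)
    (hleft : ∀ a ∈ A, a * (Subsemigroup.closure (⋃₀ A) : Set M) = Subsemigroup.closure (⋃₀ A))
    (hright : ∀ a ∈ A, (Subsemigroup.closure (⋃₀ A) : Set M) * a = Subsemigroup.closure (⋃₀ A)) :
    (Subsemigroup.closure (⋃₀ A) : Set M) ∈ F := by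
  set R := Subsemigroup.closure (⋃₀ A)
  let N : Subsemigroup (Set M) :=
    { carrier := {T | T ∈ F ∧ T ⊆ R ∧ T * R = R ∧ R * T = R}
      mul_mem' := by
        rintro T T' ⟨hT, hTR, hl, hr⟩ ⟨hT', hTR', hl', hr'⟩
        exact ⟨F.mul_mem hT hT', (powersetSubsemigroup R).mul_mem hTR hTR',
          by rw [mul_assoc, hl', hl], by rw [← mul_assoc, hr, hr']⟩ }
  have hAN : A ⊆ N := fun a ha => ⟨hA ha,
    (Set.subset_sUnion_of_mem ha).trans Subsemigroup.subset_closure, hleft a ha, hright a ha⟩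
  obtain ⟨e, ⟨heF, -, hel, her⟩, he⟩ : ∃ e ∈ N, ∀ T ∈ N, e * T * e ⊆ e := by
    refine exists_mul_mul_subset_self (hfin.finite_subsets.subset fun T hT => hT.2.1)
      (hne.mono hAN) fun T hT n hn hidem => ?_
    obtain ⟨-, hl, hlR, hRl⟩ := pow_mem_of_ne_zero N hT hn
    obtain ⟨-, hl', hlR', hRl'⟩ := pow_mem_of_ne_zero N hT n.succ_ne_zero
    exact ⟨hF.pow_union_pow_succ_mem hT.1 hn hidem, Set.union_subset hl hl',
      by rw [Set.union_mul, hlR, hlR', Set.union_self],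
      by rw [Set.mul_union, hRl, hRl', Set.union_self]⟩
  refine hF.isLowerSet (fun x hx => ?_ : (R : Set M) ⊆ e) heF
  have hx : x ∈ e * R * e := by rwa [hel, her]
  obtain ⟨_, ⟨y, hy, z, hz, rfl⟩, t, ht, rfl⟩ := hx
  obtain ⟨T, hT, hzT⟩ := exists_mem_of_mem_closure_sUnion hAN hz
  exact he T hT (Set.mul_mem_mul (Set.mul_mem_mul hy hzT) ht)

/-- The powers `b ^ i` with large `i` satisfy `b ^ i = (b * b ^ ω) ^ i`, and `b * b ^ ω` is
contained in `T = b ^ ω ∪ b ^ (ω + 1)`, the powers of which increase up to `T ^ ω`. -/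
theorem IsFOSaturated.exists_pow_subset (hF : IsFOSaturated F) {b : Set M} (hb : b ∈ F)
    {R : Subsemigroup M} (hfin : (R : Set M).Finite) (hbR : b ⊆ R) :
    ∃ U ∈ F, ∀ i, 2 ^ (R : Set M).ncard ≤ i → b ^ i ⊆ U := by
  set N := powersetSubsemigroup R
  have hN : (N : Set (Set M)).Finite := hfin.finite_subsets
  have hbN : b ∈ N := hbR
  obtain ⟨n, hn, he, hstab⟩ := exists_isIdempotentElem_pow hN fun n hn =>
    pow_mem_of_ne_zero N hbN hn
  have hT := hF.pow_union_pow_succ_mem hb hn he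
  set T := b ^ n ∪ b ^ (n + 1)
  have heT : b ^ n * T = T := by
    simp only [T, Set.mul_union, pow_succ b n, ← mul_assoc, he.eq]
  have hmono : Monotone fun i => T ^ (i + 1) := by
    refine monotone_nat_of_le_succ fun i => ?_
    calc T ^ (i + 1) = b ^ n * T ^ (i + 1) := by rw [pow_succ' T, ← mul_assoc, heT]
      _ ⊆ T * T ^ (i + 1) := Set.mul_subset_mul_right Set.subset_union_left
      _ = T ^ (i + 2) := (pow_succ' _ _).symm
  have hTN : T ∈ N := Set.union_subset (pow_mem_of_ne_zero N hbN hn)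
    (pow_mem_of_ne_zero N hbN n.succ_ne_zero)
  obtain ⟨m, hm, hidem, -⟩ := exists_isIdempotentElem_pow hN fun n hn =>
    pow_mem_of_ne_zero N hTN hn
  refine ⟨T ^ m, F.pow_mem hT m, fun i hi => ?_⟩
  have hcard : (N : Set (Set M)).ncard = 2 ^ (R : Set M).ncard := Set.ncard_powerset _ hfin
  have hi0 : i ≠ 0 := (Nat.two_pow_pos _ |>.trans_le hi).ne'
  calc b ^ i = (b * b ^ n) ^ i := by
        rw [(Commute.self_pow b n).mul_pow, he.pow_eq hi0, hstab i (hcard ▸ hi)]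
    _ ⊆ T ^ i := Set.pow_subset_pow_left (by rw [← pow_succ']; exact Set.subset_union_right)
    _ ⊆ T ^ (m * i) := by
        have := hmono (Nat.sub_le_sub_right (Nat.le_mul_of_pos_left i (Nat.pos_of_ne_zero hm)) 1)
        simpa [Nat.sub_one_add_one hi0, Nat.sub_one_add_one (mul_ne_zero hm hi0)] using this
    _ = T ^ m := by rw [pow_mul, hidem.pow_eq hi0]

end Saturated

/-! ### Bounding the values of words of equal type -/

section TypesBounded

variable {M : Type u} [Monoid M] {F : Submonoid (Set M)} {A A' : Set (Set M)} {k k' : ℕ}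

/-- The values of all words over `A` of the same type of rank `k` are contained in a common member
of `F`. -/
def TypesBoundedIn (F : Submonoid (Set M)) (A : Set (Set M)) (k : ℕ) : Prop :=
  ∀ w, ∃ U ∈ F, ∀ v, (∀ a ∈ v, a ∈ A) → rankType k v = rankType k w → v.prod ⊆ U

theorem TypesBoundedIn.mono (h : TypesBoundedIn F A k) (hA : A' ⊆ A) (hk : k ≤ k') :
    TypesBoundedIn F A' k' := fun w =>
  (h w).imp fun _ hU => ⟨hU.1, fun v hv hvw =>
    hU.2 v (fun a ha => hA (hv a ha)) (rankType_eq_of_le hk hvw)⟩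

theorem typesBoundedIn_empty : TypesBoundedIn F ∅ k := fun _ =>
  ⟨1, F.one_mem, fun v hv _ => by
    rw [List.eq_nil_iff_forall_not_mem.2 hv, List.prod_nil]⟩

theorem typesBoundedIn_of_closure_mem (h : (Subsemigroup.closure (⋃₀ A) : Set M) ∈ F) :
    TypesBoundedIn F A (k + 1) := by
  intro w
  rcases eq_or_ne w [] with rfl | hw
  · exact ⟨1, F.one_mem, fun v _ hvw => by
      rw [eq_nil_of_rankType_succ_eq hvw.symm, List.prod_nil]⟩
  · refine ⟨_, h, fun v hv hvw => prod_subset_closure_sUnion hv ?_⟩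
    rintro rfl
    exact hw (eq_nil_of_rankType_succ_eq hvw)

theorem IsFOSaturated.typesBoundedIn_singleton (hF : IsFOSaturated F) {b : Set M} (hb : b ∈ F)
    {R : Subsemigroup M} (hfin : (R : Set M).Finite) (hbR : b ⊆ R) :
    TypesBoundedIn F {b} (2 ^ (R : Set M).ncard) := by
  obtain ⟨U, hUF, hU⟩ := hF.exists_pow_subset hb hfin hbR
  intro w
  have prod_eq : ∀ v : List (Set M), (∀ a ∈ v, a ∈ ({b} : Set (Set M))) →
      v.prod = b ^ v.length := fun v hv => List.prod_eq_pow_card v b hv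
  by_cases hw : 2 ^ (R : Set M).ncard ≤ w.length
  · refine ⟨U, hUF, fun v hv hvw => prod_eq v hv ▸ hU _ ?_⟩
    have := length_eq_or_le_of_rankType_eq hvw
    omega
  · refine ⟨b ^ w.length, F.pow_mem hb _, fun v hv hvw => ?_⟩
    have hlen : v.length = w.length := by
      have := length_eq_or_le_of_rankType_eq hvw
      omega
    rw [prod_eq v hv, hlen]

/-- The set of values of the blocks over `A` of type `τ`: the letter that replaces such a block. -/
def blockValue (p : Set M → Prop) (A : Set (Set M)) (j : ℕ) (τ : RankType (Set M) j) : Set M :=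
  ⋃₀ (List.prod '' {z | (∀ a ∈ z, a ∈ A) ∧ IsBlock p z ∧ rankType j z = τ})

variable {p : Set M → Prop} {j : ℕ}

theorem prod_subset_blockValue {z : List (Set M)} (hz : ∀ a ∈ z, a ∈ A) (hp : IsBlock p z) :
    z.prod ⊆ blockValue p A j (rankType j z) :=
  Set.subset_sUnion_of_mem ⟨z, ⟨hz, hp, rfl⟩, rfl⟩

theorem prod_flatten_subset_prod_blockValue {Z : List (List (Set M))}
    (hZ : ∀ z ∈ Z, ∀ a ∈ z, a ∈ A) (hp : ∀ z ∈ Z, IsBlock p z) :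
    Z.flatten.prod ⊆ (Z.map fun z => blockValue p A j (rankType j z)).prod := by
  induction Z with
  | nil => rfl
  | cons z Z ih =>
    rw [List.forall_mem_cons] at hZ hp
    rw [List.flatten_cons, List.prod_append, List.map_cons, List.prod_cons]
    exact Set.mul_subset_mul (prod_subset_blockValue hZ.1 hp.1) (ih hZ.2 hp.2)

theorem IsFOSaturated.blockValue_mem (hF : IsFOSaturated F)
    (hP : TypesBoundedIn F {a ∈ A | p a} (j + 1)) (hN : TypesBoundedIn F {a ∈ A | ¬p a} (j + 1))
    (τ : RankType (Set M) (j + 2)) : blockValue p A (j + 2) τ ∈ F := by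
  by_cases h : ∃ z, IsBlock p z ∧ rankType (j + 2) z = τ
  · obtain ⟨_, ⟨x, _ | ⟨b, y⟩, rfl, -, hy, hpx, hpy⟩, rfl⟩ := h
    · exact absurd rfl hy
    obtain ⟨U, hUF, hU⟩ := hP x
    obtain ⟨V, hVF, hV⟩ := hN (b :: y)
    refine hF.isLowerSet (Set.sUnion_subset ?_) (F.mul_mem hUF hVF)
    rintro _ ⟨_, ⟨hA, ⟨x', _ | ⟨b', y'⟩, rfl, -, hy', hpx', hpy'⟩, hτ⟩, rfl⟩
    · exact absurd rfl hy'
    rw [List.forall_mem_append] at hA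
    obtain ⟨hx, hy⟩ := rankType_eq_and_of_append_left hpx' (by simpa using hpy' b' (by simp))
      hpx (by simpa using hpy b (by simp)) hτ
    rw [List.prod_append]
    exact Set.mul_subset_mul (hU _ (fun a ha => ⟨hA.1 a ha, hpx' a ha⟩) hx)
      (hV _ (fun a ha => ⟨hA.2 a ha, hpy' a ha⟩) hy)
  · refine hF.isLowerSet (Set.sUnion_subset ?_) F.one_mem
    rintro _ ⟨z, ⟨-, hz, hτ⟩, rfl⟩
    exact absurd ⟨z, hz, hτ⟩ h

/-- A word is cut into a run of letters outside `p`, a sequence of blocks and a run of letters in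
`p`; the sequence of blocks is read as a word over the alphabet of the block values. -/
theorem TypesBoundedIn.of_blocks
    (hP : TypesBoundedIn F {a ∈ A | p a} (j + 1)) (hN : TypesBoundedIn F {a ∈ A | ¬p a} (j + 1))
    (hblock : TypesBoundedIn F (Set.range (blockValue p A (j + 2))) k) :
    TypesBoundedIn F A (k + j + 6) := by
  intro w
  obtain ⟨y, Z, x, rfl, hy, hZ, hx⟩ := exists_eq_append_flatten_append p w
  obtain ⟨U, hUF, hU⟩ := hN y
  obtain ⟨V, hVF, hV⟩ := hblock (Z.map fun z => blockValue p A (j + 2) (rankType (j + 2) z))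
  obtain ⟨W, hWF, hW⟩ := hP x
  refine ⟨U * (V * W), F.mul_mem hUF (F.mul_mem hVF hWF), fun v hv hvw => ?_⟩
  obtain ⟨y', Z', x', rfl, hy', hZ', hx'⟩ := exists_eq_append_flatten_append p v
  simp only [List.forall_mem_append, List.mem_flatten] at hv
  obtain ⟨hAy, hAZ, hAx⟩ := hv
  obtain ⟨htype_y, h⟩ := rankType_eq_and_of_append_left (p := fun a => ¬p a) hy'
    (by simpa using of_mem_head?_flatten_append hZ' hx') hy
    (by simpa using of_mem_head?_flatten_append hZ hx) hvw
  obtain ⟨htype_Z, htype_x⟩ := rankType_eq_and_of_append_right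
    (not_of_mem_getLast?_flatten hZ') hx' (not_of_mem_getLast?_flatten hZ) hx h
  have htype_blocks := rankType_map (blockValue p A (j + 2))
    (rankType_map_eq_of_flatten (k := k) (j := j + 1) hZ' hZ htype_Z)
  simp only [List.map_map] at htype_blocks
  rw [List.prod_append, List.prod_append]
  refine Set.mul_subset_mul (hU _ (fun a ha => ⟨hAy a ha, hy' a ha⟩)
    (rankType_eq_of_le (by omega) htype_y)) (Set.mul_subset_mul ?_
      (hW _ (fun a ha => ⟨hAx a ha, hx' a ha⟩) (rankType_eq_of_le (by omega) htype_x)))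
  exact (prod_flatten_subset_prod_blockValue (fun z hz a ha => hAZ a ⟨z, hz, ha⟩) hZ').trans
    (hV _ (by simp) htype_blocks)

theorem blockValue_subset {Q : Set M} {τ : RankType (Set M) j}
    (hQ : ∀ x y : List (Set M), (∀ a ∈ x, a ∈ A ∧ p a) → (∀ a ∈ y, a ∈ A ∧ ¬p a) → x ≠ [] → y ≠ [] →
      (x ++ y).prod ⊆ Q) :
    blockValue p A j τ ⊆ Q := by
  refine Set.sUnion_subset ?_
  rintro _ ⟨_, ⟨hA, ⟨x, y, rfl, hx, hy, hpx, hpy⟩, -⟩, rfl⟩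
  rw [List.forall_mem_append] at hA
  exact hQ x y (fun a ha => ⟨hA.1 a ha, hpx a ha⟩) (fun a ha => ⟨hA.2 a ha, hpy a ha⟩) hx hy

theorem coe_closure_range_blockValue_subset {Q : Subsemigroup M}
    (hQ : ∀ τ, blockValue p A j τ ⊆ Q) :
    (Subsemigroup.closure (⋃₀ Set.range (blockValue p A j)) : Set M) ⊆ Q :=
  SetLike.coe_subset_coe.2 (Subsemigroup.closure_le.2
    (Set.sUnion_subset (Set.forall_mem_range.2 hQ)))

theorem ncard_range_blockValue_le {Q : Set M} (hfin : Q.Finite)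
    (hQ : ∀ τ, blockValue p A j τ ⊆ Q) :
    (Set.range (blockValue p A j)).ncard ≤ 2 ^ Q.ncard :=
  Set.ncard_powerset Q hfin ▸ Set.ncard_le_ncard (Set.range_subset_iff.2 hQ) hfin.finite_subsets

theorem exists_coe_eq_mul_right {R : Subsemigroup M} {b : Set M} (hb : b ⊆ R) :
    ∃ Q : Subsemigroup M, (Q : Set M) = R * b :=
  ⟨{ carrier := R * b
     mul_mem' := by
      rintro _ _ ⟨r, hr, s, hs, rfl⟩ ⟨r', hr', s', hs', rfl⟩
      exact ⟨r * s * r', R.mul_mem (R.mul_mem hr (hb hs)) hr', s', hs', by simp only [mul_assoc]⟩ },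
    rfl⟩

theorem exists_coe_eq_mul_left {R : Subsemigroup M} {b : Set M} (hb : b ⊆ R) :
    ∃ Q : Subsemigroup M, (Q : Set M) = b * R :=
  ⟨{ carrier := b * R
     mul_mem' := by
      rintro _ _ ⟨s, hs, r, hr, rfl⟩ ⟨s', hs', r', hr', rfl⟩
      exact ⟨s, hs, r * (s' * r'), R.mul_mem hr (R.mul_mem (hb hs') hr'),
        by simp only [mul_assoc]⟩ },
    rfl⟩

theorem prod_append_subset_closure_mul {b : Set M} {x y : List (Set M)} (hb : b ∈ A)
    (hx : ∀ a ∈ x, a ∈ A) (hy : ∀ a ∈ y, a = b) (hxne : x ≠ []) (hyne : y ≠ []) :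
    (x ++ y).prod ⊆ Subsemigroup.closure (⋃₀ A) * b := by
  obtain ⟨y, c, rfl⟩ := y.eq_nil_or_concat'.resolve_left hyne
  obtain rfl := hy c (by simp)
  rw [← List.append_assoc, List.prod_append, List.prod_singleton]
  refine Set.mul_subset_mul_right (prod_subset_closure_sUnion ?_ (by simp [hxne]))
  exact List.forall_mem_append.2 ⟨hx, fun a ha => hy a (by simp [ha]) ▸ hb⟩

theorem prod_append_subset_mul_closure {b : Set M} {x y : List (Set M)} (hb : b ∈ A)
    (hx : ∀ a ∈ x, a = b) (hy : ∀ a ∈ y, a ∈ A) (hxne : x ≠ []) (hyne : y ≠ []) :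
    (x ++ y).prod ⊆ b * Subsemigroup.closure (⋃₀ A) := by
  obtain ⟨c, x, rfl⟩ := List.exists_cons_of_ne_nil hxne
  obtain rfl := hx c (by simp)
  rw [List.cons_append, List.prod_cons]
  refine Set.mul_subset_mul_left (prod_subset_closure_sUnion ?_ (by simp [hyne]))
  exact List.forall_mem_append.2 ⟨fun a ha => hx a (by simp [ha]) ▸ hb, hy⟩

/-- The cost of a block decomposition of `m + 1` letters that generate a semigroup of `n + 1`
elements: at most `2 ^ n` block values, which generate a semigroup of at most `n` elements, then `m`
letters and a single letter, and five rounds for the borders of the blocks. -/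
theorem rank_recursion_le {m n : ℕ} (hn : n ≠ 0) :
    2 ^ n * 2 ^ n ^ 2 + (m * 2 ^ (n + 1) ^ 2 + 2 ^ (n + 1)) + 5 ≤ (m + 1) * 2 ^ (n + 1) ^ 2 := by
  have hpow : 2 ^ (n + 1) ^ 2 = 2 * (2 ^ n) ^ 2 * 2 ^ n ^ 2 := by ring
  have ha : 2 ≤ 2 ^ n := Nat.le_self_pow hn 2
  have hc : 2 ≤ 2 ^ n ^ 2 := Nat.le_self_pow (pow_ne_zero 2 hn) 2
  rw [hpow, pow_succ 2 n]
  generalize 2 ^ n ^ 2 = c at hc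
  generalize 2 ^ n = a at ha
  nlinarith [Nat.mul_le_mul_left a hc, Nat.mul_le_mul_right (a * c) ha]

theorem IsFOSaturated.typesBoundedIn_of_blocks (hF : IsFOSaturated F) {m n : ℕ} (hn : n ≠ 0)
    {Q : Subsemigroup M} (hQfin : (Q : Set M).Finite) (hQn : (Q : Set M).ncard ≤ n)
    (hP : TypesBoundedIn F {a ∈ A | p a} (m * 2 ^ (n + 1) ^ 2 + 2 ^ (n + 1)))
    (hN : TypesBoundedIn F {a ∈ A | ¬p a} (m * 2 ^ (n + 1) ^ 2 + 2 ^ (n + 1)))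
    (hQ : ∀ x y : List (Set M), (∀ a ∈ x, a ∈ A ∧ p a) → (∀ a ∈ y, a ∈ A ∧ ¬p a) → x ≠ [] → y ≠ [] →
      (x ++ y).prod ⊆ Q)
    (ih : ∀ {A' : Set (Set M)}, A' ⊆ F → (Subsemigroup.closure (⋃₀ A') : Set M).Finite →
      A'.ncard ≤ 2 ^ n → (Subsemigroup.closure (⋃₀ A') : Set M).ncard ≤ n →
      TypesBoundedIn F A' (2 ^ n * 2 ^ n ^ 2)) :
    TypesBoundedIn F A ((m + 1) * 2 ^ (n + 1) ^ 2) := by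
  have hle := rank_recursion_le (m := m) hn
  obtain ⟨j, hj⟩ : ∃ j, m * 2 ^ (n + 1) ^ 2 + 2 ^ (n + 1) = j + 1 :=
    Nat.exists_eq_add_one.2 (by positivity)
  rw [hj] at hP hN hle
  have hsub : ∀ τ, blockValue p A (j + 2) τ ⊆ Q := fun τ => blockValue_subset hQ
  have hclosure := coe_closure_range_blockValue_subset hsub
  refine (hP.of_blocks hN (ih (Set.range_subset_iff.2 (hF.blockValue_mem hP hN))
    (hQfin.subset hclosure) ?_ ?_)).mono subset_rfl (by omega)
  · exact (ncard_range_blockValue_le hQfin hsub).trans (Nat.pow_le_pow_right two_pos hQn)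
  · exact (Set.ncard_le_ncard hclosure hQfin).trans hQn

theorem IsFOSaturated.typesBoundedIn_of_mul_ne (hF : IsFOSaturated F) {m n : ℕ} (hn0 : n ≠ 0)
    (hA : A ⊆ F) (hfin : (Subsemigroup.closure (⋃₀ A) : Set M).Finite)
    (hn : (Subsemigroup.closure (⋃₀ A) : Set M).ncard ≤ n + 1) {b : Set M} (hb : b ∈ A)
    (hmul : (Subsemigroup.closure (⋃₀ A) : Set M) * b ≠ Subsemigroup.closure (⋃₀ A) ∨
      b * (Subsemigroup.closure (⋃₀ A) : Set M) ≠ Subsemigroup.closure (⋃₀ A))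
    (hrest : TypesBoundedIn F {a ∈ A | a ≠ b} (m * 2 ^ (n + 1) ^ 2))
    (ih : ∀ {A' : Set (Set M)}, A' ⊆ F → (Subsemigroup.closure (⋃₀ A') : Set M).Finite →
      A'.ncard ≤ 2 ^ n → (Subsemigroup.closure (⋃₀ A') : Set M).ncard ≤ n →
      TypesBoundedIn F A' (2 ^ n * 2 ^ n ^ 2)) :
    TypesBoundedIn F A ((m + 1) * 2 ^ (n + 1) ^ 2) := by
  set R := Subsemigroup.closure (⋃₀ A)
  have hbR : b ⊆ R := (Set.subset_sUnion_of_mem hb).trans Subsemigroup.subset_closure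
  have hrest := hrest.mono subset_rfl (Nat.le_add_right _ (2 ^ (n + 1)))
  have hsingle : TypesBoundedIn F {b} (m * 2 ^ (n + 1) ^ 2 + 2 ^ (n + 1)) :=
    (hF.typesBoundedIn_singleton (hA hb) hfin hbR).mono subset_rfl
      ((Nat.pow_le_pow_right two_pos hn).trans (Nat.le_add_left _ _))
  have hproper : ∀ {Q : Set M}, Q ⊆ R → Q ≠ R → Q.Finite ∧ Q.ncard ≤ n := fun hQR hne =>
    ⟨hfin.subset hQR, Nat.le_of_lt_succ
      ((Set.ncard_lt_ncard (hQR.ssubset_of_ne hne) hfin).trans_le hn)⟩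
  rcases hmul with hne | hne
  · obtain ⟨Q, hQ⟩ := exists_coe_eq_mul_right hbR
    obtain ⟨hQfin, hQn⟩ := hproper (Set.mul_subset_iff.2 fun x hx y hy => R.mul_mem hx (hbR hy)) hne
    refine hF.typesBoundedIn_of_blocks (p := (· ≠ b)) hn0 (hQ ▸ hQfin) (hQ ▸ hQn) hrest
      (hsingle.mono (by simp) le_rfl) (fun x y hx hy => ?_) ih
    exact hQ ▸ prod_append_subset_closure_mul hb (fun a ha => (hx a ha).1)
      fun a ha => not_not.1 (hy a ha).2
  · obtain ⟨Q, hQ⟩ := exists_coe_eq_mul_left hbR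
    obtain ⟨hQfin, hQn⟩ := hproper (Set.mul_subset_iff.2 fun x hx y hy => R.mul_mem (hbR hx) hy) hne
    refine hF.typesBoundedIn_of_blocks (p := (· = b)) hn0 (hQ ▸ hQfin) (hQ ▸ hQn)
      (hsingle.mono (by simp) le_rfl) hrest (fun x y hx hy => ?_) ih
    exact hQ ▸ prod_append_subset_mul_closure hb (fun a ha => (hx a ha).2)
      fun a ha => (hy a ha).1

theorem IsFOSaturated.typesBoundedIn_of_forall_mul_eq (hF : IsFOSaturated F) (hA : A ⊆ F)
    (hfin : (Subsemigroup.closure (⋃₀ A) : Set M).Finite)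
    (h : (Subsemigroup.closure (⋃₀ A) : Set M).Subsingleton ∨ ∀ a ∈ A,
      (Subsemigroup.closure (⋃₀ A) : Set M) * a = Subsemigroup.closure (⋃₀ A) ∧
        a * (Subsemigroup.closure (⋃₀ A) : Set M) = Subsemigroup.closure (⋃₀ A)) :
    TypesBoundedIn F A (k + 1) := by
  rcases A.eq_empty_or_nonempty with rfl | hne
  · exact typesBoundedIn_empty
  · refine typesBoundedIn_of_closure_mem ?_
    rcases h with h | h
    · exact hF.closure_mem_of_subsingleton hA h
    · exact hF.closure_mem hA hne hfin (fun a ha => (h a ha).2) fun a ha => (h a ha).1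

theorem IsFOSaturated.typesBoundedIn (hF : IsFOSaturated F) {m n : ℕ} (hA : A ⊆ F)
    (hfin : (Subsemigroup.closure (⋃₀ A) : Set M).Finite) (hm : A.ncard ≤ m)
    (hn : (Subsemigroup.closure (⋃₀ A) : Set M).ncard ≤ n) :
    TypesBoundedIn F A (m * 2 ^ n ^ 2) := by
  induction n using Nat.strong_induction_on generalizing m A with
  | h n ihn =>
  have hAfin : A.Finite := hfin.finite_subsets.subset fun a ha =>
    (Set.subset_sUnion_of_mem ha).trans Subsemigroup.subset_closure
  induction m generalizing A with
  | zero =>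
    obtain rfl := (Set.ncard_eq_zero hAfin).1 (Nat.le_zero.1 hm)
    exact typesBoundedIn_empty
  | succ m ihm =>
  by_cases h : (Subsemigroup.closure (⋃₀ A) : Set M).Subsingleton ∨ ∀ a ∈ A,
      (Subsemigroup.closure (⋃₀ A) : Set M) * a = Subsemigroup.closure (⋃₀ A) ∧
        a * (Subsemigroup.closure (⋃₀ A) : Set M) = Subsemigroup.closure (⋃₀ A)
  · exact (hF.typesBoundedIn_of_forall_mul_eq (k := 0) hA hfin h).mono subset_rfl
      (Nat.one_le_iff_ne_zero.2 (by positivity))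
  simp only [not_or, Set.not_subsingleton_iff, not_forall, not_and_or] at h
  obtain ⟨hR, b, hb, hmul⟩ := h
  have hn1 : 1 < n := (Set.one_lt_ncard_iff_nontrivial_and_finite.2 ⟨hR, hfin⟩).trans_le hn
  obtain ⟨n, rfl⟩ := Nat.exists_eq_succ_of_ne_zero (zero_lt_one.trans hn1).ne'
  refine hF.typesBoundedIn_of_mul_ne (by omega) hA hfin hn hb hmul ?_
    fun hA' hfin' hm' hn' => ihn n n.lt_succ_self hA' hfin' hm' hn'
  have hsub : {a ∈ A | a ≠ b} ⊆ A := Set.sep_subset _ _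
  have hclosure : (Subsemigroup.closure (⋃₀ {a ∈ A | a ≠ b}) : Set M) ⊆
      Subsemigroup.closure (⋃₀ A) :=
    Subsemigroup.closure_mono (Set.sUnion_subset_sUnion hsub)
  refine ihm (hsub.trans hA) (hfin.subset hclosure) ?_
    ((Set.ncard_le_ncard hclosure hfin).trans hn) (hAfin.subset hsub)
  exact Nat.le_of_lt_succ
    ((Set.ncard_lt_ncard ⟨hsub, fun h => (h hb).2 rfl⟩ hAfin).trans_le hm)

end TypesBounded

/-! ### First-order definability of types -/

section Segments

variable {α : Type u} {w : List α} {l h : ℕ}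

/-- The factor of a word that consists of the positions `i` with `l ≤ i < h`. -/
def segment (w : List α) (l h : ℕ) : List α := (w.take h).drop l

theorem segment_eq_append_cons {i : ℕ} (hi : i < w.length) (hl : l ≤ i) (hh : i < h) :
    segment w l h = segment w l i ++ w[i] :: segment w (i + 1) h := by
  have htake : (w.take h).take i = w.take i := by rw [List.take_take, min_eq_left hh.le]
  have hlen : i < (w.take h).length := by rw [List.length_take]; omega
  have hsplit := List.take_append_drop i (w.take h)
  rw [List.drop_eq_getElem_cons hlen, htake, List.getElem_take] at hsplit
  rw [segment, ← hsplit, List.drop_append_of_le_length (by rw [List.length_take]; omega)]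
  rfl

theorem segment_eq_append_cons_iff {u v : List α} {a : α} :
    segment w l h = u ++ a :: v ↔ ∃ i : Fin w.length, l ≤ i ∧ i < h ∧
      segment w l i = u ∧ w.get i = a ∧ segment w (i + 1) h = v := by
  constructor
  · intro hseg
    have hlen := congrArg List.length hseg
    simp only [segment, List.length_drop, List.length_take, List.length_append,
      List.length_cons] at hlen
    have hi : l + u.length < w.length := by omega
    have hcut := segment_eq_append_cons (l := l) (h := h) hi (by omega) (by omega)
    obtain ⟨hu, hv⟩ := List.append_inj (hseg.symm.trans hcut) (by
      simp only [segment, List.length_drop, List.length_take]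
      omega)
    obtain ⟨ha, hv⟩ := List.cons.inj hv
    exact ⟨⟨l + u.length, hi⟩, Nat.le_add_right _ _, by simp only; omega,
      hu.symm, ha.symm, hv.symm⟩
  · rintro ⟨i, hl, hh, rfl, rfl, rfl⟩
    exact segment_eq_append_cons i.2 hl hh

theorem exists_segment_eq_append_cons_iff {k : ℕ} {t : RankType α k × α × RankType α k} :
    (∃ u a v, segment w l h = u ++ a :: v ∧ (rankType k u, a, rankType k v) = t) ↔
      ∃ i : Fin w.length, l ≤ i ∧ i < h ∧ rankType k (segment w l i) = t.1 ∧
        w.get i = t.2.1 ∧ rankType k (segment w (i + 1) h) = t.2.2 := by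
  simp only [segment_eq_append_cons_iff]
  constructor
  · rintro ⟨_, _, _, ⟨i, hl, hh, rfl, rfl, rfl⟩, rfl⟩
    exact ⟨i, hl, hh, rfl, rfl, rfl⟩
  · rintro ⟨i, hl, hh, hu, ha, hv⟩
    exact ⟨_, _, _, ⟨i, hl, hh, rfl, rfl, rfl⟩, Prod.ext hu (Prod.ext ha hv)⟩

end Segments

section Definability

open FirstOrder FirstOrder.Language

variable {B : Type u}

/-- A relation of arity `n` on the positions of words that is defined by a formula of quantifier
rank at most `k`. -/
def FODef (k n : ℕ) (p : (w : FreeSemigroup B) → (Fin n → Pos w) → Prop) : Prop :=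
  ∃ φ : (wordLang B).BoundedFormula Empty n, qrank φ ≤ k ∧
    ∀ (w : FreeSemigroup B) (x : Fin n → Pos w), φ.Realize default x ↔ p w x

namespace FODef

variable {k n : ℕ} {p q : (w : FreeSemigroup B) → (Fin n → Pos w) → Prop}

theorem congr (h : FODef k n p) (hpq : ∀ w x, p w x ↔ q w x) : FODef k n q := by
  obtain ⟨φ, hφ, h⟩ := h
  exact ⟨φ, hφ, fun w x => (h w x).trans (hpq w x)⟩

theorem false : FODef (B := B) k n fun _ _ => False :=
  ⟨⊥, Nat.zero_le _, fun _ _ => BoundedFormula.realize_bot⟩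

theorem imp (hp : FODef k n p) (hq : FODef k n q) : FODef k n fun w x => p w x → q w x := by
  obtain ⟨φ, hφ, h⟩ := hp
  obtain ⟨ψ, hψ, h'⟩ := hq
  exact ⟨φ.imp ψ, max_le hφ hψ, fun w x => by rw [BoundedFormula.realize_imp, h, h']⟩

theorem not (hp : FODef k n p) : FODef k n fun w x => ¬ p w x := hp.imp false

theorem true : FODef (B := B) k n fun _ _ => True := false.not.congr (by simp)

theorem const (c : Prop) : FODef (B := B) k n fun _ _ => c := by
  by_cases h : c
  · exact true.congr (by simp [h])
  · exact false.congr (by simp [h])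

theorem and (hp : FODef k n p) (hq : FODef k n q) : FODef k n fun w x => p w x ∧ q w x :=
  (hp.imp hq.not).not.congr (by simp)

theorem iff (hp : FODef k n p) (hq : FODef k n q) : FODef k n fun w x => p w x ↔ q w x :=
  ((hp.imp hq).and (hq.imp hp)).congr fun _ _ => iff_def.symm

theorem forall_finite {ι : Type*} [Finite ι]
    {p : ι → (w : FreeSemigroup B) → (Fin n → Pos w) → Prop} (hp : ∀ i, FODef k n (p i)) :
    FODef k n fun w x => ∀ i, p i w x := by
  cases nonempty_fintype ι
  suffices h : ∀ s : Finset ι, FODef k n fun w x => ∀ i ∈ s, p i w x from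
    (h Finset.univ).congr (by simp)
  intro s
  classical
  induction s using Finset.induction_on with
  | empty => exact true.congr (by simp)
  | insert i s _ ih => exact ((hp i).and ih).congr (by simp)

theorem forall_pos {p : (w : FreeSemigroup B) → (Fin (n + 1) → Pos w) → Prop}
    (hp : FODef k (n + 1) p) : FODef (k + 1) n fun w x => ∀ i, p w (Fin.snoc x i) := by
  obtain ⟨φ, hφ, h⟩ := hp
  exact ⟨φ.all, Nat.succ_le_succ hφ, fun w x => by
    rw [BoundedFormula.realize_all]
    exact forall_congr' fun i => h w _⟩

theorem exists_pos {p : (w : FreeSemigroup B) → (Fin (n + 1) → Pos w) → Prop}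
    (hp : FODef k (n + 1) p) : FODef (k + 1) n fun w x => ∃ i, p w (Fin.snoc x i) :=
  hp.not.forall_pos.not.congr (by simp)

theorem letter (b : B) (i : Fin n) : FODef k n fun w x => (letters w).get (x i) = b :=
  ⟨.rel (WordRel.letter b) fun _ => Term.var (Sum.inr i), Nat.zero_le _, fun _ _ => Iff.rfl⟩

theorem lt (i j : Fin n) : FODef (B := B) k n fun _ x => Fin.val (x i) < Fin.val (x j) :=
  ⟨.rel WordRel.lt ![Term.var (Sum.inr i), Term.var (Sum.inr j)], Nat.zero_le _,
    fun _ _ => Iff.rfl⟩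

end FODef

/-- The first position after the variable `o`, or after the start of the word. -/
def lo {n : ℕ} (o : Option (Fin n)) {w : FreeSemigroup B} (x : Fin n → Pos w) : ℕ :=
  o.elim 0 fun i => Fin.val (x i) + 1

/-- The position of the variable `o`, or the end of the word. -/
def hi {n : ℕ} (o : Option (Fin n)) {w : FreeSemigroup B} (x : Fin n → Pos w) : ℕ :=
  o.elim (letters w).length fun i => Fin.val (x i)

theorem lo_snoc {n : ℕ} (o : Option (Fin n)) {w : FreeSemigroup B} (x : Fin n → Pos w)
    (i : Pos w) : lo (o.map Fin.castSucc) (Fin.snoc (α := fun _ => Pos w) x i) = lo o x := by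
  cases o <;> simp [lo]

theorem hi_snoc {n : ℕ} (o : Option (Fin n)) {w : FreeSemigroup B} (x : Fin n → Pos w)
    (i : Pos w) : hi (o.map Fin.castSucc) (Fin.snoc (α := fun _ => Pos w) x i) = hi o x := by
  cases o <;> simp [hi]

theorem lo_last {n : ℕ} {w : FreeSemigroup B} (x : Fin n → Pos w) (i : Pos w) :
    lo (some (Fin.last n)) (Fin.snoc (α := fun _ => Pos w) x i) = Fin.val i + 1 := by
  simp [lo]

theorem hi_last {n : ℕ} {w : FreeSemigroup B} (x : Fin n → Pos w) (i : Pos w) :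
    hi (some (Fin.last n)) (Fin.snoc (α := fun _ => Pos w) x i) = Fin.val i := by
  simp [hi]

theorem FODef.lo_le {k n : ℕ} (o : Option (Fin n)) (j : Fin n) :
    FODef (B := B) k n fun _ x => lo o x ≤ Fin.val (x j) := by
  cases o with
  | none => exact FODef.true.congr (by simp [lo])
  | some i => exact (FODef.lt i j).congr fun _ _ => Nat.lt_iff_add_one_le

theorem FODef.lt_hi {k n : ℕ} (o : Option (Fin n)) (j : Fin n) :
    FODef (B := B) k n fun _ x => Fin.val (x j) < hi o x := by
  cases o with
  | none => exact FODef.true.congr fun w x => (iff_true_intro (x j).isLt).symm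
  | some i => exact FODef.lt j i

theorem FODef.rankType_segment [Finite B] {k n : ℕ} (l h : Option (Fin n)) (τ : RankType B k) :
    FODef k n fun w x => rankType k (segment (letters w) (lo l x) (hi h x)) = τ := by
  induction k generalizing n with
  | zero => exact FODef.true.congr fun _ _ => (iff_true_intro rfl).symm
  | succ k ih =>
    suffices key : ∀ τ : Set (RankType B k × B × RankType B k), FODef (k + 1) n fun w x =>
        rankType (k + 1) (segment (letters w) (lo l x) (hi h x)) = τ from key τ
    intro τ
    refine (FODef.forall_finite fun t => FODef.iff ?_ (FODef.const (t ∈ τ))).congr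
      fun w x => rankType_succ_eq_iff.symm
    have split_at := (FODef.lo_le (l.map Fin.castSucc) (Fin.last n)).and
      ((FODef.lt_hi (h.map Fin.castSucc) (Fin.last n)).and
      ((ih (l.map Fin.castSucc) (some (Fin.last n)) t.1).and
      ((FODef.letter t.2.1 (Fin.last n)).and
      (ih (some (Fin.last n)) (h.map Fin.castSucc) t.2.2))))
    refine split_at.exists_pos.congr fun w x =>
      (exists_congr fun i => ?_).trans exists_segment_eq_append_cons_iff.symm
    rw [lo_snoc, hi_snoc, lo_last, hi_last, Fin.snoc_last]

theorem exists_sentence_rankType_eq [Finite B] (k : ℕ) (τ : RankType B k) :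
    ∃ φ : (wordLang B).Sentence, definedBy φ = {w | rankType k (letters w) = τ} ∧ qrank φ ≤ k := by
  obtain ⟨φ, hφ, h⟩ := FODef.rankType_segment (B := B) (n := 0) none none τ
  refine ⟨φ, Set.ext fun w => (h w default).trans ?_, hφ⟩
  simp [lo, hi, segment]

end Definability

/-! ### Saturation in the monoid `WithOne S` -/

section WithOne

variable {S : Type v} [Semigroup S] {𝒮 : Subsemigroup (Set S)}

theorem image_coe_mul (T T' : Set S) :
    ((↑) '' (T * T') : Set (WithOne S)) = (↑) '' T * (↑) '' T' :=
  Set.image_mul WithOne.coeMulHom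

theorem image_coe_spow (T : Set S) (n : ℕ+) :
    ((↑) '' spow T n : Set (WithOne S)) = ((↑) '' T) ^ (n : ℕ) := by
  induction n using PNat.recOn with
  | one => rw [spow_one, PNat.one_coe, pow_one]
  | succ n ih => rw [spow_succ, image_coe_mul, ih, PNat.add_coe, PNat.one_coe, pow_succ]

/-- The saturation of `𝒮` as a submonoid of the subsets of `WithOne S`; adjoining `1` gives a value
to the empty word. -/
def satWithOne (𝒮 : Subsemigroup (Set S)) : Submonoid (Set (WithOne S)) where
  carrier := {U | U ⊆ 1 ∨ ∃ T ∈ Sat 𝒮, (↑) '' T = U}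
  one_mem' := .inl subset_rfl
  mul_mem' := by
    rintro U V (hU | ⟨T, hT, rfl⟩) (hV | ⟨T', hT', rfl⟩)
    · exact .inl ((Set.mul_subset_mul hU hV).trans_eq (one_mul 1))
    · rcases Set.subset_singleton_iff_eq.1 hU with rfl | rfl
      · simp
      · exact .inr ⟨T', hT', (one_mul _).symm⟩
    · rcases Set.subset_singleton_iff_eq.1 hV with rfl | rfl
      · simp
      · exact .inr ⟨T, hT, (mul_one _).symm⟩
    · exact .inr ⟨T * T', hT.mul hT', image_coe_mul T T'⟩

theorem isFOSaturated_satWithOne (𝒮 : Subsemigroup (Set S)) : IsFOSaturated (satWithOne 𝒮) where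
  isLowerSet := by
    rintro U V hVU (hU | ⟨T, hT, rfl⟩)
    · exact .inl (hVU.trans hU)
    · obtain ⟨T', hT', rfl⟩ := Set.subset_image_iff.1 hVU
      exact .inr ⟨T', hT.downset hT', rfl⟩
  pow_union_pow_succ_mem := by
    rintro _ n (hU | ⟨T, hT, rfl⟩) hn hidem
    · have hpow : ∀ n, _ ^ n ⊆ (1 : Set (WithOne S)) := fun n =>
        (Set.pow_subset_pow_left hU).trans_eq (one_pow n)
      exact .inl (Set.union_subset (hpow n) (hpow (n + 1)))
    · lift n to ℕ+ using Nat.pos_of_ne_zero hn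
      refine .inr ⟨_, hT.foClosure n ?_, ?_⟩
      · rw [← image_coe_spow, IsIdempotentElem, ← image_coe_mul] at hidem
        exact Set.image_injective.2 WithOne.coe_injective hidem
      · rw [Set.image_union, image_coe_spow, image_coe_spow, PNat.add_coe, PNat.one_coe]

theorem mem_sat_of_image_coe_mem_satWithOne (h : (Sat 𝒮).Nonempty) {T : Set S}
    (hT : (↑) '' T ∈ satWithOne 𝒮) : T ∈ Sat 𝒮 := by
  rcases hT with hT | ⟨T', hT', himage⟩
  · obtain ⟨T', hT'⟩ := h
    refine hT'.downset fun s hs => ?_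
    exact absurd (hT ⟨s, hs, rfl⟩) (WithOne.coe_ne_one)
  · rwa [← Set.image_injective.2 WithOne.coe_injective himage]

theorem closure_sUnion_subset_image_coe {A : Set (Set (WithOne S))}
    (hA : ∀ a ∈ A, ∃ T ∈ 𝒮, (↑) '' T = a) :
    (Subsemigroup.closure (⋃₀ A) : Set (WithOne S)) ⊆ (↑) '' ⋃₀ (𝒮 : Set (Set S)) := by
  intro x hx
  induction hx using Subsemigroup.closure_induction with
  | mem x hx =>
    obtain ⟨a, ha, hxa⟩ := hx
    obtain ⟨T, hT, rfl⟩ := hA a ha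
    exact Set.image_mono (Set.subset_sUnion_of_mem hT) hxa
  | mul x y _ _ hx hy =>
    obtain ⟨s, ⟨T, hT, hs⟩, rfl⟩ := hx
    obtain ⟨s', ⟨T', hT', hs'⟩, rfl⟩ := hy
    exact ⟨s * s', ⟨T * T', 𝒮.mul_mem hT hT', Set.mul_mem_mul hs hs'⟩, rfl⟩

variable {B : Type u}

theorem image_coe_eq_prod_map_letters (β : FreeSemigroup B →ₙ* 𝒮) (w : FreeSemigroup B) :
    ((↑) '' (β w : Set S) : Set (WithOne S)) =
      ((letters w).map fun b => (↑) '' (β (FreeSemigroup.of b) : Set S)).prod := by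
  induction w using FreeSemigroup.recOnMul with
  | ih1 b => exact List.prod_singleton.symm
  | ih2 b w _ ih =>
    rw [map_mul, MulMemClass.coe_mul, image_coe_mul, ih]
    exact List.prod_cons.symm

theorem sUnion_image_rankType_eq_mem_sat [Finite B] (hfin : (⋃₀ (𝒮 : Set (Set S))).Finite)
    (β : FreeSemigroup B →ₙ* 𝒮) (w : FreeSemigroup B) {k : ℕ}
    (hk : Nat.card B * 2 ^ (⋃₀ (𝒮 : Set (Set S))).ncard ^ 2 ≤ k) :
    ⋃₀ ((fun v => (β v : Set S)) '' {v | rankType k (letters v) = rankType k (letters w)}) ∈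
      Sat 𝒮 := by
  set g : B → Set (WithOne S) := fun b => (↑) '' (β (FreeSemigroup.of b) : Set S)
  have hg : ∀ a ∈ Set.range g, ∃ T ∈ 𝒮, (↑) '' T = a :=
    Set.forall_mem_range.2 fun b => ⟨_, (β (FreeSemigroup.of b)).2, rfl⟩
  have hgF : Set.range g ⊆ satWithOne 𝒮 := fun a ha =>
    (hg a ha).elim fun T hT => .inr ⟨T, .base hT.1, hT.2⟩
  have hclosure := closure_sUnion_subset_image_coe hg
  obtain ⟨U, hUF, hU⟩ := ((isFOSaturated_satWithOne 𝒮).typesBoundedIn hgF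
    ((hfin.image _).subset hclosure)
    ((Nat.card_coe_set_eq _).symm.trans_le (Finite.card_range_le g))
    ((Set.ncard_le_ncard hclosure (hfin.image _)).trans (Set.ncard_image_le hfin))).mono
      subset_rfl hk ((letters w).map g)
  refine mem_sat_of_image_coe_mem_satWithOne ⟨β w, .base (β w).2⟩
    ((isFOSaturated_satWithOne 𝒮).isLowerSet ?_ hUF)
  rw [Set.sUnion_image, Set.image_iUnion₂]
  refine Set.iUnion₂_subset fun v hv => ?_
  rw [image_coe_eq_prod_map_letters]
  exact hU _ (List.forall_mem_map.2 fun b _ => ⟨b, rfl⟩) (rankType_map g hv)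

end WithOne

end FOSeparation

open FOSeparation in
theorem mainTheorem3_general {S : Type*} [Semigroup S] {B : Type*} [Finite B]
    (𝒮 : Subsemigroup (Set S)) (h𝒮 : (⋃₀ (𝒮 : Set (Set S))).Finite)
    (β : FreeSemigroup B →ₙ* 𝒮) :
    ∃ P : Set (Set (FreeSemigroup B)), IsFOPartition P ∧
      ∀ K ∈ P,
        ⋃₀ ((fun w => (β w : Set S)) '' K) ∈ Sat 𝒮 ∧
        ∃ φ : (wordLang B).Sentence,
          definedBy φ = K ∧
          qrank φ ≤ Nat.card B * 2 ^ ((⋃₀ (𝒮 : Set (Set S))).ncard ^ 2) := by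
  set k := Nat.card B * 2 ^ ((⋃₀ (𝒮 : Set (Set S))).ncard ^ 2)
  let sameType : Setoid (FreeSemigroup B) := Setoid.ker fun w => rankType k (letters w)
  have hdef : ∀ K ∈ sameType.classes, ∃ φ : (wordLang B).Sentence,
      definedBy φ = K ∧ qrank φ ≤ k := by
    rintro _ ⟨w, rfl⟩
    exact exists_sentence_rankType_eq k (rankType k (letters w))
  refine ⟨sameType.classes, ⟨Setoid.finite_classes_ker _, Setoid.isPartition_classes _,
    fun K hK => (hdef K hK).imp fun _ h => h.1⟩, fun K hK => ⟨?_, hdef K hK⟩⟩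
  obtain ⟨w, rfl⟩ := hK
  exact sUnion_image_rankType_eq_mem_sat h𝒮 β w le_rfl

theorem mainTheorem3 {S : Type*} [Semigroup S] [Finite S] {B : Type*} [Finite B]
    (𝒮 : Subsemigroup (Set S)) (β : FreeSemigroup B →ₙ* 𝒮) (hβ : Function.Surjective β) :
    ∃ P : Set (Set (FreeSemigroup B)), FOSeparation.IsFOPartition P ∧
      ∀ K ∈ P,
        ⋃₀ ((fun w => (β w : Set S)) '' K) ∈ FOSeparation.Sat 𝒮 ∧
        ∃ φ : (FOSeparation.wordLang B).Sentence,
          FOSeparation.definedBy φ = K ∧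
          FOSeparation.qrank φ ≤ Nat.card B * 2 ^ ((⋃₀ (𝒮 : Set (Set S))).ncard ^ 2) :=
  mainTheorem3_general 𝒮 (Set.toFinite _) β
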